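/- Let $E$ be a finite-dimensional $\mathbb{Q}$-vector space with a positive definite symmetric bilinear form $(\cdot,\cdot)$, let $\Phi\subseteq E$ be an irreducible reduced crystallographic root system spanning $E$, and let $\Pi=\{\alpha_i\mid i\in I\}$ be a set of simple roots of $\Phi$. Write $\alpha^\vee=\frac{2}{(\alpha,\alpha)}\alpha$ for $\alpha\in\Phi$. For $\alpha\in\Phi$ and $i\in I$ with $\alpha\neq\pm\alpha_i$ put $m_i^+(\alpha)=p+1$ and $m_i^-(\alpha)=q+1$, where $\alpha-q\alpha_i,\ldots,\alpha,\ldots,\alpha+p\alpha_i$ is the $\alpha_i$-string through $\alpha$. Let $M$ be a $\mathbb{C}$-vector space with a basis $\{u_i\mid i\in I\}\cup\{v_\alpha\mid\alpha\in\Phi\}$, and define linear maps $e_i,f_i,h_i\colon M\to M$ $(i\in I)$ by $$e_i(u_j)=|(\alpha_i,\alpha_j^\vee)|\,v_{\alpha_i},\qquad e_i(v_\alpha)=\begin{cases} m_i^-(\alpha)\,v_{\alpha+\alpha_i}&\text{if }\alpha+\alpha_i\in\Phi,\\ u_i&\text{if }\alpha=-\alpha_i,\\ 0&\text{otherwise,}\end{cases}$$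 $$f_i(u_j)=|(\alpha_i,\alpha_j^\vee)|\,v_{-\alpha_i},\qquad f_i(v_\alpha)=\begin{cases} m_i^+(\alpha)\,v_{\alpha-\alpha_i}&\text{if }\alpha-\alpha_i\in\Phi,\\ u_i&\text{if }\alpha=\alpha_i,\\ 0&\text{otherwise,}\end{cases}$$ $$h_i(u_j)=0,\qquad h_i(v_\alpha)=(\alpha,\alpha_i^\vee)\,v_\alpha .$$ Let $\mathfrak{g}\subseteq\mathfrak{gl}(M)$ be the Lie subalgebra generated by all $e_i,f_i$ $(i\in I)$, and let $\mathfrak{h}$ be the $\mathbb{C}$-span of the $h_i$ $(i\in I)$. Then $\mathfrak{h}\subseteq\mathfrak{g}$, the Lie algebra $\mathfrak{g}$ is simple, and $\mathfrak{h}$ is a Cartan subalgebra of $\mathfrak{g}$. For $\alpha\in\Phi$ let $\dot\alpha\in\mathfrak{h}^*$ be the linear form with $\dot\alpha(h_j)=(\alpha,\alpha_j^\vee)$ for all $j\in I$, let $\dot\Phi=\{\dot\alpha\mid\alpha\in\Phi\}$, and for $\lambda\in\mathfrak{h}^*$ let $\mathfrak{g}_\lambda=\{x\in\mathfrak{g}\mid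 [h,x]=\lambda(h)x\text{ for all }h\in\mathfrak{h}\}$. Then $\dot\Phi$ is the root system of $\mathfrak{g}$ with respect to $\mathfrak{h}$; that is, $\dot\Phi=\{\lambda\in\mathfrak{h}^*\mid\lambda\neq0,\ \mathfrak{g}_\lambda\neq0\}$. The map $\alpha\mapsto\dot\alpha$ is an isomorphism of root systems from $\Phi$ onto $\dot\Phi$: it is the restriction of an injective $\mathbb{Q}$-linear map $E\to\mathfrak{h}^*$ and preserves all Cartan integers. Moreover, $$\mathfrak{g}=\mathfrak{h}\oplus\bigoplus_{\alpha\in\Phi}\mathfrak{g}_{\dot\alpha},\qquad \dim\mathfrak{g}_{\dot\alpha}=1\ \text{ for all }\alpha\in\Phi .$$ -/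

import Mathlib

attribute [local instance 100] LieRing.ofAssociativeRing

set_option linter.unusedSectionVars false

namespace CanonicalModel

noncomputable section

variable {ι E N V : Type*} [Finite ι]
  [AddCommGroup E] [Module ℚ E] [AddCommGroup N] [Module ℚ N]
  [AddCommGroup V] [Module ℂ V]
  {P : RootPairing ι ℚ E N} [P.IsCrystallographic]

/-- `m⁺_α(β) = p + 1`, where `β - q α, …, β + p α` is the `α`-string through `β`.
It is only meaningful for `β ≠ ± α`. -/
def mPlus (P : RootPairing ι ℚ E N) [P.IsCrystallographic] (α β : ι) : ℕ :=
  P.chainTopCoeff α β + 1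

/-- `m⁻_α(β) = q + 1`, where `β - q α, …, β + p α` is the `α`-string through `β`.
It is only meaningful for `β ≠ ± α`. -/
def mMinus (P : RootPairing ι ℚ E N) [P.IsCrystallographic] (α β : ι) : ℕ :=
  P.chainBotCoeff α β + 1

/- Throughout, `B` is a basis of the complex vector space `V` indexed by the disjoint union of the
simple roots and all the roots: `u_j = B (.inl j)` and `v_α = B (.inr α)`. -/

open Classical in
/-- The operator `e_i`. Here `h.choose` is the unique root `α + α_i`. -/
def e (b : P.Base) (B : Module.Basis (b.support ⊕ ι) ℂ V) (i : b.support) : Module.End ℂ V :=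
  B.constr ℂ (Sum.elim
    (fun j => ((|P.pairing i j| : ℚ) : ℂ) • B (.inr i))
    (fun α =>
      if h : ∃ β, P.root β = P.root α + P.root i then (mMinus P i α : ℂ) • B (.inr h.choose)
      else if P.root α = -P.root i then B (.inl i)
      else 0))

open Classical in
/-- The operator `f_i`. Here `h.choose` is the unique root `α - α_i` (for the value at `v_α`) or
the root `-α_i` (for the value at `u_j`). -/
def f (b : P.Base) (B : Module.Basis (b.support ⊕ ι) ℂ V) (i : b.support) : Module.End ℂ V :=
  B.constr ℂ (Sum.elim
    (fun j => ((|P.pairing i j| : ℚ) : ℂ) • B (.inr (P.reflectionPerm i i)))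
    (fun α =>
      if h : ∃ β, P.root β = P.root α - P.root i then (mPlus P i α : ℂ) • B (.inr h.choose)
      else if P.root α = P.root i then B (.inl i)
      else 0))

/-- The operator `h_i`. -/
def h (b : P.Base) (B : Module.Basis (b.support ⊕ ι) ℂ V) (i : b.support) : Module.End ℂ V :=
  B.constr ℂ (Sum.elim (fun _ => 0) (fun α => (P.pairing α i : ℂ) • B (.inr α)))

/-- The root `-α_i`, which indexes the basis vector `v_{-α_i}` in the definition of `f`. -/
lemma root_reflectionPerm_self (P : RootPairing ι ℚ E N) (i : ι) :
    P.root (P.reflectionPerm i i) = -P.root i := by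
  simp

/-- The Lie algebra `𝔤 ⊆ 𝔤𝔩(V)` generated by all the `e_i` and `f_i`. -/
def lieAlg (b : P.Base) (B : Module.Basis (b.support ⊕ ι) ℂ V) :
    LieSubalgebra ℂ (Module.End ℂ V) :=
  LieSubalgebra.lieSpan ℂ (Module.End ℂ V) (Set.range (e b B) ∪ Set.range (f b B))

lemma h_comm (b : P.Base) (B : Module.Basis (b.support ⊕ ι) ℂ V) (i j : b.support) :
    ⁅h b B i, h b B j⁆ = 0 := by
  rw [LieRing.of_associative_ring_bracket, sub_eq_zero]
  refine B.ext ?_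
  rintro (k | α)
  · simp [h]
  · simp [h, smul_smul, mul_comm]

/-- The span of the `h_i` in `𝔤𝔩(V)`. -/
def hSpan (b : P.Base) (B : Module.Basis (b.support ⊕ ι) ℂ V) :
    LieSubalgebra ℂ (Module.End ℂ V) where
  __ := Submodule.span ℂ (Set.range (h b B))
  lie_mem' {x y} hx hy := by
    have key : ⁅x, y⁆ = 0 := by
      change x ∈ Submodule.span ℂ (Set.range (h b B)) at hx
      change y ∈ Submodule.span ℂ (Set.range (h b B)) at hy
      induction hx, hy using Submodule.span_induction₂ with
      | mem_mem x y hx hy =>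
        obtain ⟨i, rfl⟩ := hx
        obtain ⟨j, rfl⟩ := hy
        exact h_comm b B i j
      | zero_left y hy => simp
      | zero_right x hx => simp
      | add_left x y z hx hy hz h1 h2 => simp [h1, h2]
      | add_right x y z hx hy hz h1 h2 => simp [h1, h2]
      | smul_left r x y hx hy h1 => simp [h1]
      | smul_right r x y hx hy h1 => simp [h1]
    rw [key]
    exact Submodule.zero_mem _

/-- The span `𝔥` of the `h_i`, as a subalgebra of `𝔤`. (That the `h_i` lie in `𝔤`, so that nothing
is lost here, is not built into this definition.) -/
def cartan (b : P.Base) (B : Module.Basis (b.support ⊕ ι) ℂ V) : LieSubalgebra ℂ (lieAlg b B) :=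
  (hSpan b B).comap (lieAlg b B).incl

/-- The linear form `α̇` on `𝔥`: the coefficient of `v_α` in `x v_α`, for `x ∈ 𝔥`. By
`dot_apply_h` it is the linear form with `α̇(h_j) = (α, α_j^∨)` for all `j`. -/
def dot (b : P.Base) (B : Module.Basis (b.support ⊕ ι) ℂ V) (α : ι) :
    Module.Dual ℂ (cartan b B) where
  toFun x := B.coord (.inr α) ((((x : lieAlg b B) : Module.End ℂ V)) (B (.inr α)))
  map_add' x y := by simp
  map_smul' c x := by simp

lemma dot_apply_h (b : P.Base) (B : Module.Basis (b.support ⊕ ι) ℂ V) (α : ι) (j : b.support)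
    (x : cartan b B) (hx : ((x : lieAlg b B) : Module.End ℂ V) = h b B j) :
    dot b B α x = (P.pairing α j : ℂ) := by
  simp [dot, hx, h]

/-- The space `𝔤_lam = {x ∈ 𝔤 | [y, x] = lam(y) x for all y ∈ 𝔥}`, for `lam ∈ 𝔥^*`. -/
def rootSpace (b : P.Base) (B : Module.Basis (b.support ⊕ ι) ℂ V)
    (lam : Module.Dual ℂ (cartan b B)) : Submodule ℂ (lieAlg b B) where
  carrier := {x | ∀ y : cartan b B, ⁅(y : lieAlg b B), x⁆ = lam y • x}
  add_mem' hx hy z := by rw [lie_add, hx z, hy z, smul_add]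
  zero_mem' z := by simp
  smul_mem' c x hx z := by rw [lie_smul, hx z, smul_comm]

instance (b : P.Base) (B : Module.Basis (b.support ⊕ ι) ℂ V) : FiniteDimensional ℂ (lieAlg b B) :=
  have : FiniteDimensional ℂ V := B.finiteDimensional_of_finite
  inferInstanceAs (FiniteDimensional ℂ (lieAlg b B).toSubmodule)

end

end CanonicalModel

/-! The operators `e_i`, `f_i`, `h_i` are those of Geck's construction. Extending scalars from `ℚ`
to `ℂ` keeps pairings, strings, reducedness and irreducibility, so in the basis `B` they have
exactly Geck's matrices for the complexified root system. The Chevalley relations, the independence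
of the `h_i` and the nondegeneracy of the Killing form carry over from the matrices to `𝔤`.

The relations make `𝔥` a Cartan subalgebra and give the root system of `(𝔤, 𝔥)` a base with the
Cartan matrix of `Φ`. A reduced crystallographic root system is determined by its Cartan matrix,
which yields the equivalence `rootSystemEquiv`. Irreducibility passes through it, so `𝔤` is simple.
Evaluation on the `h_j` shows that the root matched with `α` is `α̇`
(`root_indexEquiv_rootSystemEquiv`); the description of the roots, the one-dimensional root spaces
and the decomposition of `𝔤` are then the general theory of Lie algebras with nondegenerate Killing
form. -/

namespace RootPairing

open Module Set TensorProduct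

/-! ### Extension of scalars for root systems -/

section BaseChange

variable {ι k M N : Type*} [Field k] [AddCommGroup M] [Module k M]
  [AddCommGroup N] [Module k N]

lemma oneTmul_injective (K M : Type*) {k : Type*} [Field k] [Field K] [Algebra k K]
    [AddCommGroup M] [Module k M] : Function.Injective (TensorProduct.mk k K M 1) :=
  Module.Flat.tensorProduct_mk_injective (R := k) (S := K) (M := M)

section Finite

variable [Finite ι]

lemma finite_of_isRootSystem (P : RootPairing ι k M N) [P.IsRootSystem] : Module.Finite k M :=
  .of_fg_top (IsRootSystem.span_root_eq_top (P := P) ▸ Submodule.fg_span (finite_range _))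

variable (K : Type*) [Field K] [Algebra k K] (P : RootPairing ι k M N) [P.IsRootSystem]

/-- The base change along a field extension of the perfect pairing of a root system. -/
noncomputable def baseChangeEquiv : K ⊗[k] M ≃ₗ[K] Dual K (K ⊗[k] N) :=
  -- Finiteness of `N` is what identifies `K ⊗ Dual k N` with `Dual K (K ⊗ N)`.
  have : Module.Finite k N := P.flip.finite_of_isRootSystem
  (P.toPerfPair.baseChange k K M (Dual k N)).trans
    (TensorProduct.isBaseChange k N K).toDualBaseChange

@[simp] lemma baseChangeEquiv_one_tmul_one_tmul (x : M) (y : N) :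
    P.baseChangeEquiv K (1 ⊗ₜ x) (1 ⊗ₜ y) = algebraMap k K (P.toLinearMap x y) := by
  have : Module.Finite k N := P.flip.finite_of_isRootSystem
  simpa [baseChangeEquiv] using
    (TensorProduct.isBaseChange k N K).toDualBaseChange_tmul 1 (P.toPerfPair x) y

/-- The base change of a root system along a field extension. -/
noncomputable def baseChange : RootPairing ι K (K ⊗[k] M) (K ⊗[k] N) :=
  have : Module.Finite k M := P.finite_of_isRootSystem
  have : Module.Finite k N := P.flip.finite_of_isRootSystem
  { toLinearMap := P.baseChangeEquiv K
    isPerfPair_toLinearMap := inferInstance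
    root := P.root.trans ⟨_, oneTmul_injective K M⟩
    coroot := P.coroot.trans ⟨_, oneTmul_injective K N⟩
    root_coroot_two i := by simp [map_ofNat]
    reflectionPerm := P.reflectionPerm
    reflectionPerm_root i j := by
      simp [-root_reflectionPerm, ← P.reflectionPerm_root, tmul_sub,
        Algebra.algebraMap_eq_smul_one]
    reflectionPerm_coroot i j := by
      simp [-coroot_reflectionPerm, ← P.reflectionPerm_coroot, tmul_sub,
        Algebra.algebraMap_eq_smul_one] }

lemma baseChange_root (i : ι) : (P.baseChange K).root i = 1 ⊗ₜ P.root i := rfl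

lemma baseChange_coroot (i : ι) : (P.baseChange K).coroot i = 1 ⊗ₜ P.coroot i := rfl

@[simp] lemma baseChange_pairing (i j : ι) :
    (P.baseChange K).pairing i j = algebraMap k K (P.pairing i j) :=
  P.baseChangeEquiv_one_tmul_one_tmul K _ _

lemma baseChange_reflection_one_tmul (i : ι) (x : M) :
    (P.baseChange K).reflection i (1 ⊗ₜ x) = 1 ⊗ₜ P.reflection i x := by
  have : (P.baseChange K).coroot' i (1 ⊗ₜ x) = algebraMap k K (P.coroot' i x) :=
    P.baseChangeEquiv_one_tmul_one_tmul K _ _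
  simp [reflection_apply, baseChange_root, this, tmul_sub, Algebra.algebraMap_eq_smul_one]

omit [Finite ι] in
lemma span_range_one_tmul_eq_top {v : ι → M} (hv : Submodule.span k (range v) = ⊤) :
    Submodule.span K (range fun i ↦ (1 : K) ⊗ₜ[k] v i) = ⊤ := by
  have : (fun i ↦ (1 : K) ⊗ₜ[k] v i) = TensorProduct.mk k K M 1 ∘ v := rfl
  rw [this, range_comp, ← Submodule.baseChange_span, hv, Submodule.baseChange_top]

instance : (P.baseChange K).IsRootSystem where
  span_root_eq_top := span_range_one_tmul_eq_top K IsRootSystem.span_root_eq_top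
  span_coroot_eq_top := span_range_one_tmul_eq_top K IsRootSystem.span_coroot_eq_top

lemma linearIndependent_pair_baseChange {i j : ι}
    (h : LinearIndependent k ![P.root i, P.root j]) :
    LinearIndependent K ![(P.baseChange K).root i, (P.baseChange K).root j] := by
  convert Module.Flat.linearIndependent_one_tmul (S := K) h using 1
  ext x
  fin_cases x <;> rfl

instance [P.IsCrystallographic] : (P.baseChange K).IsCrystallographic where
  exists_value i j := by
    obtain ⟨z, hz⟩ := P.exists_value (S := ℤ) i j
    exact ⟨z, by simp [← hz]⟩

@[simp] lemma baseChange_pairingIn [P.IsCrystallographic] [CharZero K] (i j : ι) :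
    (P.baseChange K).pairingIn ℤ i j = P.pairingIn ℤ i j := by
  apply FaithfulSMul.algebraMap_injective ℤ K
  rw [algebraMap_pairingIn, baseChange_pairing, ← P.algebraMap_pairingIn ℤ]
  simp [-algebraMap_pairingIn]

instance [P.IsReduced] : (P.baseChange K).IsReduced where
  eq_or_eq_neg i j h := by
    have := mt (P.linearIndependent_pair_baseChange K) h
    refine (IsReduced.eq_or_eq_neg i j this).imp ?_ ?_
    · intro hij; simp [baseChange_root, hij]
    · intro hij; simp [baseChange_root, hij, tmul_neg]

/-- A nonzero invariant `q` contains a vector `x` on which some coroot does not vanish, and `x - s_i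
x` is then a nonzero multiple of the root `1 ⊗ α_i`. So the `k`-subspace of those `x` with `1 ⊗ x ∈
q` is invariant and nonzero, hence everything, and `q` contains all roots. -/
instance [P.IsIrreducible] [CharZero k] : (P.baseChange K).IsIrreducible := by
  have := IsIrreducible.nontrivial P
  have : Nontrivial (K ⊗[k] M) := (oneTmul_injective K M).nontrivial
  refine .mk' _ fun q hq hq₀ ↦ ?_
  let q' : Submodule k M := (q.restrictScalars k).comap (TensorProduct.mk k K M 1)
  have hq' (x : M) : x ∈ q' ↔ (1 : K) ⊗ₜ[k] x ∈ q := Iff.rfl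
  suffices q' = ⊤ by
    rw [eq_top_iff, ← IsRootSystem.span_root_eq_top (P := P.baseChange K), Submodule.span_le]
    rintro - ⟨i, rfl⟩
    rw [baseChange_root, SetLike.mem_coe, ← hq', this]
    trivial
  refine IsIrreducible.eq_top_of_invtSubmodule_reflection (P := P) q' (fun i x hx ↦ ?_) ?_
  · have := hq i hx
    rwa [Submodule.mem_comap, TensorProduct.mk_apply, LinearEquiv.coe_coe,
      baseChange_reflection_one_tmul] at this
  · obtain ⟨x, hx, hx₀⟩ := q.ne_bot_iff.mp hq₀
    obtain ⟨i, hi⟩ : ∃ i, (P.baseChange K).coroot' i x ≠ 0 := by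
      contrapose! hx₀
      apply (P.baseChange K).toPerfPair.injective
      rw [map_zero]
      refine LinearMap.ext_on_range (IsRootSystem.span_coroot_eq_top (P := P.baseChange K)) hx₀
    refine (Submodule.ne_bot_iff _).mpr ⟨P.root i, (hq' _).mpr ?_, P.ne_zero i⟩
    have := q.sub_mem hx (hq i hx)
    rwa [LinearEquiv.coe_coe, reflection_apply, sub_sub_cancel, q.smul_mem_iff hi] at this

variable {P} in
/-- The base change of a base of a root system along a field extension. -/
noncomputable def Base.baseChange (b : P.Base) : (P.baseChange K).Base where
  support := b.support
  linearIndepOn_root := Module.Flat.linearIndependent_one_tmul b.linearIndepOn_root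
  linearIndepOn_coroot := Module.Flat.linearIndependent_one_tmul b.linearIndepOn_coroot
  root_mem_or_neg_mem i := by
    have (x : M) (hx : x ∈ AddSubmonoid.closure (P.root '' b.support)) :
        (1 : K) ⊗ₜ[k] x ∈ AddSubmonoid.closure ((P.baseChange K).root '' b.support) := by
      have := AddSubmonoid.mem_map_of_mem (TensorProduct.mk k K M 1) hx
      rwa [AddMonoidHom.map_mclosure, ← image_comp] at this
    exact (b.root_mem_or_neg_mem i).imp (this _) fun h ↦ by
      simpa [baseChange_root, baseChange_coroot, tmul_neg] using this _ h
  coroot_mem_or_neg_mem i := by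
    have (x : N) (hx : x ∈ AddSubmonoid.closure (P.coroot '' b.support)) :
        (1 : K) ⊗ₜ[k] x ∈ AddSubmonoid.closure ((P.baseChange K).coroot '' b.support) := by
      have := AddSubmonoid.mem_map_of_mem (TensorProduct.mk k K N 1) hx
      rwa [AddMonoidHom.map_mclosure, ← image_comp] at this
    exact (b.coroot_mem_or_neg_mem i).imp (this _) fun h ↦ by
      simpa [baseChange_root, baseChange_coroot, tmul_neg] using this _ h

@[simp] lemma baseChange_root_eq_add_iff {i j l : ι} :
    (P.baseChange K).root i = (P.baseChange K).root j + (P.baseChange K).root l ↔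
      P.root i = P.root j + P.root l := by
  simp only [baseChange_root, ← tmul_add]
  exact (oneTmul_injective K M).eq_iff

@[simp] lemma baseChange_root_eq_sub_iff {i j l : ι} :
    (P.baseChange K).root i = (P.baseChange K).root j - (P.baseChange K).root l ↔
      P.root i = P.root j - P.root l := by
  simp only [baseChange_root, ← tmul_sub]
  exact (oneTmul_injective K M).eq_iff

lemma one_tmul_mem_range_baseChange_root_iff (x : M) :
    (1 : K) ⊗ₜ[k] x ∈ range (P.baseChange K).root ↔ x ∈ range P.root :=
  exists_congr fun _ ↦ (oneTmul_injective K M).eq_iff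

variable [CharZero k] [CharZero K] [P.IsCrystallographic]

/-- For independent roots the coefficient is determined by which `α_j + n α_i` are roots, and `x ↦ 1
⊗ x` preserves and reflects being a root. -/
lemma chainTopCoeff_baseChange {i j : ι} (h : LinearIndependent k ![P.root i, P.root j]) :
    (P.baseChange K).chainTopCoeff i j = P.chainTopCoeff i j := by
  refine eq_of_forall_le_iff fun n ↦ ?_
  rw [← root_add_nsmul_mem_range_iff_le_chainTopCoeff h,
    ← root_add_nsmul_mem_range_iff_le_chainTopCoeff (P.linearIndependent_pair_baseChange K h),
    ← one_tmul_mem_range_baseChange_root_iff K P, tmul_add, tmul_smul]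
  rfl

lemma chainBotCoeff_baseChange {i j : ι} (h : LinearIndependent k ![P.root i, P.root j]) :
    (P.baseChange K).chainBotCoeff i j = P.chainBotCoeff i j := by
  refine eq_of_forall_le_iff fun n ↦ ?_
  rw [← root_sub_nsmul_mem_range_iff_le_chainBotCoeff h,
    ← root_sub_nsmul_mem_range_iff_le_chainBotCoeff (P.linearIndependent_pair_baseChange K h),
    ← one_tmul_mem_range_baseChange_root_iff K P, tmul_sub, tmul_smul]
  rfl

end Finite

end BaseChange

end RootPairing

namespace CanonicalModel

open Set RootPairing GeckConstruction Module

/-! ### Entries of Geck's matrices in terms of the rational root system -/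

section Matrices

variable {ι E N : Type*} [Finite ι]
  [AddCommGroup E] [Module ℚ E] [AddCommGroup N] [Module ℚ N]
  {P : RootPairing ι ℚ E N} [P.IsRootSystem] [P.IsCrystallographic]
  {b : P.Base} (i : b.support)

/-- The matrix of `h_i` provided by Geck's construction for the complexified root system. -/
noncomputable def hMatrix : Matrix (b.support ⊕ ι) (b.support ⊕ ι) ℂ :=
  GeckConstruction.h (b := b.baseChange ℂ) i

/-- The matrix of `e_i` provided by Geck's construction for the complexified root system. -/
noncomputable def eMatrix : Matrix (b.support ⊕ ι) (b.support ⊕ ι) ℂ :=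
  GeckConstruction.e (b := b.baseChange ℂ) i

/-- The matrix of `f_i` provided by Geck's construction for the complexified root system. -/
noncomputable def fMatrix : Matrix (b.support ⊕ ι) (b.support ⊕ ι) ℂ :=
  GeckConstruction.f (b := b.baseChange ℂ) i

lemma cartanMatrix_baseChange (i j : b.support) :
    (b.baseChange ℂ).cartanMatrix i j = P.pairingIn ℤ i j :=
  P.baseChange_pairingIn ℂ i j

omit [Finite ι] [P.IsRootSystem] in
lemma cast_pairing (α β : ι) : (P.pairing α β : ℂ) = P.pairingIn ℤ α β := by
  rw [← P.algebraMap_pairingIn ℤ]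
  simp [-algebraMap_pairingIn]

omit [Finite ι] [P.IsRootSystem] in
lemma cast_abs_pairing (α β : ι) :
    ((|P.pairing α β| : ℚ) : ℂ) = (|P.pairingIn ℤ α β| : ℤ) := by
  rw [← P.algebraMap_pairingIn ℤ, algebraMap_int_eq, eq_intCast, ← Int.cast_abs, Rat.cast_intCast]

@[simp] lemma hMatrix_inl (j : b.support) (x : b.support ⊕ ι) : hMatrix i x (.inl j) = 0 := by
  cases x <;> rfl

@[simp] lemma hMatrix_inl_inr (j : b.support) (α : ι) : hMatrix i (.inl j) (.inr α) = 0 := rfl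

open Classical in
lemma hMatrix_inr_inr (β α : ι) :
    hMatrix i (.inr β) (.inr α) = if β = α then (P.pairing α i : ℂ) else 0 := by
  have : hMatrix i (.inr β) (.inr α) =
      if β = α then ((P.baseChange ℂ).pairingIn ℤ β i : ℂ) else 0 := rfl
  rw [this, P.baseChange_pairingIn ℂ, ← cast_pairing]
  exact if_ctx_congr Iff.rfl (fun h ↦ by rw [h]) fun _ ↦ rfl

@[simp] lemma eMatrix_inl_inl (j k : b.support) : eMatrix i (.inl k) (.inl j) = 0 := rfl

open Classical in
lemma eMatrix_inr_inl (j : b.support) (β : ι) :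
    eMatrix i (.inr β) (.inl j) = if β = i then ((|P.pairing i j| : ℚ) : ℂ) else 0 := by
  rw [cast_abs_pairing, ← cartanMatrix_baseChange]
  rfl

open Classical in
lemma eMatrix_inl_inr (k : b.support) (α : ι) :
    eMatrix i (.inl k) (.inr α) = if k = i ∧ P.root α = -P.root i then 1 else 0 := by
  rw [P.root_eq_neg_iff]
  rfl

open Classical in
-- String lengths are only known to survive base change for independent roots. Where the entry is
-- nonzero, `α + α_i` is a root, and reducedness then forces `α` and `α_i` to be independent.
lemma eMatrix_inr_inr [P.IsReduced] (β α : ι) :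
    eMatrix i (.inr β) (.inr α) =
      if P.root β = P.root α + P.root i then (mMinus P i α : ℂ) else 0 := by
  have h₀ : eMatrix i (.inr β) (.inr α) =
    if (P.baseChange ℂ).root β = (P.baseChange ℂ).root i + (P.baseChange ℂ).root α then
      ((P.baseChange ℂ).chainBotCoeff i α + 1 : ℂ) else 0 := rfl
  rw [h₀, baseChange_root_eq_add_iff, add_comm (P.root i)]
  refine if_ctx_congr Iff.rfl (fun h ↦ ?_) fun _ ↦ rfl
  rw [P.chainBotCoeff_baseChange ℂ (P.linearIndependent_of_add_mem_range_root'
    ⟨β, by rw [h, add_comm]⟩), mMinus, Nat.cast_add, Nat.cast_one]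

@[simp] lemma fMatrix_inl_inl (j k : b.support) : fMatrix i (.inl k) (.inl j) = 0 := rfl

open Classical in
lemma fMatrix_inr_inl (j : b.support) (β : ι) :
    fMatrix i (.inr β) (.inl j) =
      if β = P.reflectionPerm i i then ((|P.pairing i j| : ℚ) : ℂ) else 0 := by
  rw [cast_abs_pairing, ← cartanMatrix_baseChange]
  rfl

open Classical in
lemma fMatrix_inl_inr (k : b.support) (α : ι) :
    fMatrix i (.inl k) (.inr α) = if k = i ∧ P.root α = P.root i then 1 else 0 := by
  rw [P.root.injective.eq_iff]
  rfl

open Classical in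
lemma fMatrix_inr_inr [P.IsReduced] (β α : ι) :
    fMatrix i (.inr β) (.inr α) =
      if P.root β = P.root α - P.root i then (mPlus P i α : ℂ) else 0 := by
  have h₀ : fMatrix i (.inr β) (.inr α) =
    if (P.baseChange ℂ).root β = (P.baseChange ℂ).root α - (P.baseChange ℂ).root i then
      ((P.baseChange ℂ).chainTopCoeff i α + 1 : ℂ) else 0 := rfl
  rw [h₀, baseChange_root_eq_sub_iff]
  refine if_ctx_congr Iff.rfl (fun h ↦ ?_) fun _ ↦ rfl
  rw [P.chainTopCoeff_baseChange ℂ (LinearIndependent.pair_symm_iff.mp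
    (P.linearIndependent_of_sub_mem_range_root' ⟨β, h⟩)), mPlus, Nat.cast_add, Nat.cast_one]

end Matrices

/-! ### The operators have Geck's matrices -/

variable {ι E N V : Type*} [Fintype ι] [DecidableEq ι]
  [AddCommGroup E] [Module ℚ E] [AddCommGroup N] [Module ℚ N]
  [AddCommGroup V] [Module ℂ V]
  {P : RootPairing ι ℚ E N}
  (b : P.Base) (B : Module.Basis (b.support ⊕ ι) ℂ V)

/-- The identification of matrices with endomorphisms, as an equivalence of Lie algebras. -/
noncomputable def toLinLieEquiv :
    Matrix (b.support ⊕ ι) (b.support ⊕ ι) ℂ ≃ₗ⁅ℂ⁆ Module.End ℂ V where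
  __ := (Matrix.toLinAlgEquiv B).toLinearEquiv
  map_lie' {x y} := by simp [Ring.lie_def]

lemma toLinLieEquiv_apply_basis (A) (j) :
    toLinLieEquiv b B A (B j) = ∑ i, A i j • B i :=
  Matrix.toLinAlgEquiv_self B A j

variable [P.IsRootSystem] [P.IsCrystallographic]

lemma toLinLieEquiv_hMatrix (i : b.support) : toLinLieEquiv b B (hMatrix i) = h b B i := by
  refine B.ext ?_
  rintro (j | α) <;> simp [toLinLieEquiv_apply_basis, h, hMatrix_inr_inr]

omit [Fintype ι] [DecidableEq ι] [P.IsRootSystem] in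
lemma e_apply_inr [Finite ι] {i : b.support} {α β : ι} (hβ : P.root β = P.root α + P.root i) :
    e b B i (B (.inr α)) = (mMinus P i α : ℂ) • B (.inr β) := by
  have hex : ∃ β, P.root β = P.root α + P.root i := ⟨β, hβ⟩
  have hc : hex.choose = β := P.root.injective (hex.choose_spec.trans hβ.symm)
  simp only [e, Basis.constr_basis, Sum.elim_inr, dif_pos hex, hc]

lemma toLinLieEquiv_eMatrix [P.IsReduced] (i : b.support) :
    toLinLieEquiv b B (eMatrix i) = e b B i := by
  refine B.ext ?_
  rintro (j | α)
  · simp [toLinLieEquiv_apply_basis, e, eMatrix_inr_inl]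
  · by_cases hα : ∃ β, P.root β = P.root α + P.root i
    · obtain ⟨β, hβ⟩ := hα
      -- A column of the matrix adds up the cases that the operator separates; they exclude each
      -- other because `0` is not a root.
      have hne : P.root α ≠ -P.root i := fun h' ↦ P.ne_zero β (by simpa [h'] using hβ)
      rw [e_apply_inr b B hβ]
      simp [toLinLieEquiv_apply_basis, eMatrix_inl_inr, eMatrix_inr_inr, hne, ← hβ,
        -root_eq_neg_iff]
    · simp [toLinLieEquiv_apply_basis, e, eMatrix_inl_inr, eMatrix_inr_inr, not_exists.mp hα,
        ite_and, -root_eq_neg_iff]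

omit [Fintype ι] [DecidableEq ι] [P.IsRootSystem] in
lemma f_apply_inr [Finite ι] {i : b.support} {α β : ι} (hβ : P.root β = P.root α - P.root i) :
    f b B i (B (.inr α)) = (mPlus P i α : ℂ) • B (.inr β) := by
  have hex : ∃ β, P.root β = P.root α - P.root i := ⟨β, hβ⟩
  have hc : hex.choose = β := P.root.injective (hex.choose_spec.trans hβ.symm)
  simp only [f, Basis.constr_basis, Sum.elim_inr, dif_pos hex, hc]

lemma toLinLieEquiv_fMatrix [P.IsReduced] (i : b.support) :
    toLinLieEquiv b B (fMatrix i) = f b B i := by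
  refine B.ext ?_
  rintro (j | α)
  · simp [toLinLieEquiv_apply_basis, f, fMatrix_inr_inl]
  · by_cases hα : ∃ β, P.root β = P.root α - P.root i
    · obtain ⟨β, hβ⟩ := hα
      have hne : P.root α ≠ P.root i := fun h' ↦ P.ne_zero β (by simpa [h'] using hβ)
      rw [f_apply_inr b B hβ]
      simp [toLinLieEquiv_apply_basis, fMatrix_inl_inr, fMatrix_inr_inr, hne, ← hβ,
        -root_eq_neg_iff]
    · simp [toLinLieEquiv_apply_basis, f, fMatrix_inl_inr, fMatrix_inr_inr, not_exists.mp hα,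
        ite_and, -EmbeddingLike.apply_eq_iff_eq]

end CanonicalModel

/-! ### Pairings and irreducibility under equivalence of root systems -/

namespace RootPairing.Equiv

open Module

variable {ι ι₂ K M N M₂ N₂ : Type*} [Field K] [AddCommGroup M] [Module K M] [AddCommGroup N]
  [Module K N] [AddCommGroup M₂] [Module K M₂] [AddCommGroup N₂] [Module K N₂]
  {P : RootPairing ι K M N} {P₂ : RootPairing ι₂ K M₂ N₂} (Q : P.Equiv P₂)

include Q

lemma toLinearMap_weightMap (x : M) (y : N₂) :
    P₂.toLinearMap (Q.weightMap x) y = P.toLinearMap x (Q.coweightMap y) :=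
  LinearMap.congr_fun (Hom.weight_coweight_transpose_apply P P₂ y Q.toHom) x

lemma toLinearMap_weightMap_coroot (x : M) (j : ι) :
    P₂.toLinearMap (Q.weightMap x) (P₂.coroot (Q.indexEquiv j)) = P.toLinearMap x (P.coroot j) := by
  rw [toLinearMap_weightMap, Hom.coroot_coweightMap_apply P P₂ _ Q.toHom, Equiv.symm_apply_apply]

lemma pairing_indexEquiv (i j : ι) :
    P₂.pairing (Q.indexEquiv i) (Q.indexEquiv j) = P.pairing i j := by
  have := Q.toLinearMap_weightMap_coroot (P.root i) j
  rwa [Hom.root_weightMap_apply P P₂ _ Q.toHom] at this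

lemma weightMap_reflection (i : ι) (x : M) :
    Q.weightMap (P.reflection i x) = P₂.reflection (Q.indexEquiv i) (Q.weightMap x) := by
  rw [reflection_apply, reflection_apply, map_sub, map_smul,
    Hom.root_weightMap_apply P P₂ _ Q.toHom]
  congr 2
  exact (Q.toLinearMap_weightMap_coroot x i).symm

lemma isIrreducible [P.IsIrreducible] : P₂.IsIrreducible := by
  have := IsIrreducible.nontrivial P
  have : Nontrivial M₂ := Q.bijective_weightMap.injective.nontrivial
  refine IsIrreducible.mk' P₂ fun q hq hq₀ ↦ ?_
  have htop : q.comap Q.weightMap = ⊤ := by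
    refine IsIrreducible.eq_top_of_invtSubmodule_reflection (P := P) _ (fun i x hx ↦ ?_) ?_
    · simpa [weightMap_reflection] using hq (Q.indexEquiv i) hx
    · obtain ⟨y, hy, hy₀⟩ := q.ne_bot_iff.mp hq₀
      obtain ⟨x, rfl⟩ := Q.bijective_weightMap.surjective y
      exact (Submodule.ne_bot_iff _).mpr ⟨x, hy, fun h ↦ hy₀ (by rw [h, map_zero])⟩
  rw [← Submodule.map_comap_eq_of_surjective Q.bijective_weightMap.surjective q, htop,
    Submodule.map_top, LinearMap.range_eq_top]
  exact Q.bijective_weightMap.surjective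

end RootPairing.Equiv

lemma RootPairing.Base.indexEquiv_equivOfCartanMatrixEq {ι ι₂ K M N M₂ N₂ : Type*} [Finite ι]
    [Field K] [CharZero K]
    [AddCommGroup M] [Module K M] [AddCommGroup N] [Module K N]
    [AddCommGroup M₂] [Module K M₂] [AddCommGroup N₂] [Module K N₂]
    {P : RootPairing ι K M N} [P.IsRootSystem] [P.IsCrystallographic] [P.IsReduced] (b : P.Base)
    [Finite ι₂] {P₂ : RootPairing ι₂ K M₂ N₂} [P₂.IsCrystallographic] [P₂.IsRootSystem]
    [P₂.IsReduced] (b₂ : P₂.Base) (e : b.support ≃ b₂.support)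
    (he : ∀ i j, b₂.cartanMatrix (e i) (e j) = b.cartanMatrix i j) (i : b.support) :
    (b.equivOfCartanMatrixEq b₂ e he).indexEquiv i = e i := by
  apply P₂.root.injective
  rw [← Hom.root_weightMap_apply P P₂ _ (b.equivOfCartanMatrixEq b₂ e he).toHom]
  -- By construction the weight map is the linear map matching the two bases of simple roots along
  -- `e`.
  change b.toWeightBasis.equiv b₂.toWeightBasis e (P.root i) = _
  rw [← b.toWeightBasis_apply, Module.Basis.equiv_apply, b₂.toWeightBasis_apply]

lemma LieAlgebra.Basis.cartanMatrix_base_baseSupportEquiv {ι K L : Type*} [Fintype ι] [Field K]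
    [CharZero K] [LieRing L] [LieAlgebra K L] [FiniteDimensional K L] {H : LieSubalgebra K L}
    (b : LieAlgebra.Basis ι H) [LieModule.IsTriangularizable K H L] [LieAlgebra.IsKilling K L]
    (i j : ι) :
    b.base.cartanMatrix (b.baseSupportEquiv i) (b.baseSupportEquiv j) = b.A i j := by
  simp [b.cartanMatrix_base_eq]

/-! ### Chevalley relations and semisimplicity -/

namespace CanonicalModel

open Set RootPairing GeckConstruction Module LieAlgebra

variable {ι E N V : Type*} [Fintype ι] [DecidableEq ι]
  [AddCommGroup E] [Module ℚ E] [AddCommGroup N] [Module ℚ N]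
  [AddCommGroup V] [Module ℂ V]
  {P : RootPairing ι ℚ E N} [P.IsRootSystem] [P.IsCrystallographic] [P.IsReduced]
  (b : P.Base) (B : Module.Basis (b.support ⊕ ι) ℂ V)

lemma lie_h_e (i j : b.support) : ⁅h b B j, e b B i⁆ = P.pairingIn ℤ i j • e b B i := by
  rw [← toLinLieEquiv_hMatrix, ← toLinLieEquiv_eMatrix, ← LieEquiv.map_lie,
    ← map_zsmul (toLinLieEquiv b B), ← cartanMatrix_baseChange]
  congr 1
  exact GeckConstruction.lie_h_e (b := b.baseChange ℂ) i j

lemma lie_h_f (i j : b.support) : ⁅h b B j, f b B i⁆ = -P.pairingIn ℤ i j • f b B i := by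
  rw [← toLinLieEquiv_hMatrix, ← toLinLieEquiv_fMatrix, ← LieEquiv.map_lie,
    ← map_zsmul (toLinLieEquiv b B), ← cartanMatrix_baseChange]
  congr 1
  exact GeckConstruction.lie_h_f (b := b.baseChange ℂ) i j

lemma lie_e_f_ne [P.IsIrreducible] {i j : b.support} (hij : i ≠ j) : ⁅e b B i, f b B j⁆ = 0 := by
  rw [← toLinLieEquiv_eMatrix, ← toLinLieEquiv_fMatrix, ← LieEquiv.map_lie]
  exact (congr_arg _ (GeckConstruction.lie_e_f_ne (b := b.baseChange ℂ) hij)).trans (map_zero _)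

lemma lie_e_f_same (i : b.support) : ⁅e b B i, f b B i⁆ = h b B i := by
  rw [← toLinLieEquiv_eMatrix, ← toLinLieEquiv_fMatrix, ← toLinLieEquiv_hMatrix, ← LieEquiv.map_lie]
  congr 1
  exact GeckConstruction.lie_e_f_same (b := b.baseChange ℂ) i

omit [P.IsReduced] in
lemma linearIndependent_h : LinearIndependent ℂ (h b B) := by
  have h₁ : LinearIndependent ℂ (hMatrix (b := b)) :=
    GeckConstruction.linearIndependent_h (b.baseChange ℂ)
  have h₂ : h b B = (toLinLieEquiv b B : _ →ₗ[ℂ] Module.End ℂ V) ∘ hMatrix :=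
    funext fun i ↦ (toLinLieEquiv_hMatrix b B i).symm
  rw [h₂]
  exact h₁.map' _ (LinearMap.ker_eq_bot.mpr (toLinLieEquiv b B).injective)

lemma isSl2Triple (i : b.support) : IsSl2Triple (h b B i) (e b B i) (f b B i) where
  h_ne_zero := (linearIndependent_h b B).ne_zero i
  lie_e_f := lie_e_f_same b B i
  lie_h_e_nsmul := by simp [lie_h_e, ofNat_smul_eq_nsmul]
  lie_h_f_nsmul := by simp [lie_h_f, ofNat_smul_eq_nsmul]

omit [Fintype ι] [DecidableEq ι] [P.IsRootSystem] [P.IsReduced] in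
lemma e_mem_lieAlg [Finite ι] (i : b.support) : e b B i ∈ lieAlg b B :=
  LieSubalgebra.subset_lieSpan <| by simp

omit [Fintype ι] [DecidableEq ι] [P.IsRootSystem] [P.IsReduced] in
lemma f_mem_lieAlg [Finite ι] (i : b.support) : f b B i ∈ lieAlg b B :=
  LieSubalgebra.subset_lieSpan <| by simp

lemma h_mem_lieAlg (i : b.support) : h b B i ∈ lieAlg b B :=
  lie_e_f_same b B i ▸ LieSubalgebra.lie_mem _ (e_mem_lieAlg b B i) (f_mem_lieAlg b B i)

lemma hSpan_le_lieAlg : hSpan b B ≤ lieAlg b B := by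
  change Submodule.span ℂ (range (h b B)) ≤ (lieAlg b B).toSubmodule
  rw [Submodule.span_le]
  rintro - ⟨i, rfl⟩
  exact h_mem_lieAlg b B i

/-- The Lie algebra of matrices provided by Geck's construction for the complexified root system. -/
noncomputable def matrixLieAlgebra :
    LieSubalgebra ℂ (Matrix (b.support ⊕ ι) (b.support ⊕ ι) ℂ) :=
  LieSubalgebra.lieSpan ℂ _ (range hMatrix ∪ range eMatrix ∪ range fMatrix)

lemma isKilling_matrixLieAlgebra [P.IsIrreducible] : IsKilling ℂ (matrixLieAlgebra b) :=
  inferInstanceAs (IsKilling ℂ (GeckConstruction.lieAlgebra (b.baseChange ℂ)))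

/-- The matrix algebra has the `h_i` among its generators and `lieAlg` does not; nothing changes,
since `h_i = ⁅e_i, f_i⁆`. -/
lemma map_matrixLieAlgebra :
    (matrixLieAlgebra b).map (toLinLieEquiv b B).toLieHom = lieAlg b B := by
  rw [matrixLieAlgebra, LieSubalgebra.map_lieSpan]
  refine le_antisymm (LieSubalgebra.lieSpan_le.mpr ?_) (LieSubalgebra.lieSpan_le.mpr ?_)
  · rintro - ⟨-, ((⟨i, rfl⟩ | ⟨i, rfl⟩) | ⟨i, rfl⟩), rfl⟩
    · exact toLinLieEquiv_hMatrix b B i ▸ h_mem_lieAlg b B i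
    · exact toLinLieEquiv_eMatrix b B i ▸ e_mem_lieAlg b B i
    · exact toLinLieEquiv_fMatrix b B i ▸ f_mem_lieAlg b B i
  · rintro - (⟨i, rfl⟩ | ⟨i, rfl⟩) <;> refine LieSubalgebra.subset_lieSpan ?_
    · exact ⟨eMatrix i, .inl (.inr ⟨i, rfl⟩), toLinLieEquiv_eMatrix b B i⟩
    · exact ⟨fMatrix i, .inr ⟨i, rfl⟩, toLinLieEquiv_fMatrix b B i⟩

instance [P.IsIrreducible] : IsKilling ℂ (lieAlg b B) :=
  have := isKilling_matrixLieAlgebra b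
  LieAlgebra.isKilling_of_equiv
    ((toLinLieEquiv b B).ofSubalgebras _ _ (map_matrixLieAlgebra b B))

/-- The operators `e_i`, `f_i`, `h_i` satisfy the Chevalley–Serre relations. -/
noncomputable def lieBasis [P.IsIrreducible] : LieAlgebra.Basis b.support (cartan b B) where
  A := (b.baseChange ℂ).cartanMatrix
  h i := ⟨h b B i, h_mem_lieAlg b B i⟩
  e i := ⟨e b B i, e_mem_lieAlg b B i⟩
  f i := ⟨f b B i, f_mem_lieAlg b B i⟩
  cartan_eq_lieSpan := by
    -- The linear span of the commuting `h_i` is already a subalgebra, so it is also their Lie span.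
    have : hSpan b B = LieSubalgebra.lieSpan ℂ _ (range (h b B)) :=
      le_antisymm LieSubalgebra.submodule_span_le_lieSpan
        (LieSubalgebra.lieSpan_le.mpr Submodule.subset_span)
    rw [cartan, this, ← LieSubalgebra.comap_lieSpan_range_eq]
    rfl
  span_ef := by
    refine Eq.trans (congr_arg _ ?_) (LieSubalgebra.lieSpan_lieSpan_coe_preimage (R := ℂ)
      (s := range (e b B) ∪ range (f b B)))
    ext ⟨x, hx⟩
    change _ ↔ x ∈ range (e b B) ∪ range (f b B)
    simp [Subtype.ext_iff]
  linInd := LinearIndependent.of_comp (lieAlg b B).subtype (linearIndependent_h b B)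
  nondegen := (b.baseChange ℂ).cartanMatrix_nondegenerate
  sl2 i :=
    let t := isSl2Triple b B i
    { h_ne_zero := by simp [Subtype.ext_iff, t.h_ne_zero]
      lie_e_f := by simp [Subtype.ext_iff, t.lie_e_f]
      lie_h_e_nsmul := by simp [Subtype.ext_iff, t.lie_h_e_nsmul]
      lie_h_f_nsmul := by simp [Subtype.ext_iff, t.lie_h_f_nsmul] }
  lie_h_h i j := by simp [Subtype.ext_iff, h_comm]
  lie_h_e i j := by simp [Subtype.ext_iff, lie_h_e, cartanMatrix_baseChange]
  lie_h_f i j := by simp [Subtype.ext_iff, lie_h_f, cartanMatrix_baseChange]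
  lie_e_f_ne i j hij := by simp [Subtype.ext_iff, lie_e_f_ne b B hij]

/-! ### Roots and root spaces of `𝔤` -/

variable [P.IsIrreducible]

lemma lieBasis_A_apply (i j : b.support) : (lieBasis b B).A i j = P.pairingIn ℤ i j :=
  cartanMatrix_baseChange i j

instance : (cartan b B).IsCartanSubalgebra := (lieBasis b B).isCartanSubalgebra

lemma cartanMatrix_base_lieBasis (i j : b.support) :
    (lieBasis b B).base.cartanMatrix ((lieBasis b B).baseSupportEquiv i)
      ((lieBasis b B).baseSupportEquiv j) = P.pairingIn ℤ i j := by
  rw [LieAlgebra.Basis.cartanMatrix_base_baseSupportEquiv, lieBasis_A_apply]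

/-- The complexification of `P` is the root system of the Lie algebra `lieAlg b B`. -/
noncomputable def rootSystemEquiv :
    (P.baseChange ℂ).Equiv (IsKilling.rootSystem (cartan b B)) :=
  (b.baseChange ℂ).equivOfCartanMatrixEq (lieBasis b B).base (lieBasis b B).baseSupportEquiv
    fun i j ↦ (cartanMatrix_base_lieBasis b B i j).trans (cartanMatrix_baseChange i j).symm

lemma isSimple_lieAlg : LieAlgebra.IsSimple ℂ (lieAlg b B) :=
  (IsKilling.isSimple_iff_isIrreducible (H := cartan b B)).mp (rootSystemEquiv b B).isIrreducible

lemma indexEquiv_rootSystemEquiv (i : b.support) :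
    (rootSystemEquiv b B).indexEquiv i = (lieBasis b B).baseSupportEquiv i :=
  (b.baseChange ℂ).indexEquiv_equivOfCartanMatrixEq (lieBasis b B).base _ _ i

lemma pairing_indexEquiv_rootSystemEquiv (α β : ι) :
    (IsKilling.rootSystem (cartan b B)).pairing ((rootSystemEquiv b B).indexEquiv α)
      ((rootSystemEquiv b B).indexEquiv β) = (P.pairing α β : ℂ) := by
  rw [(rootSystemEquiv b B).pairing_indexEquiv, baseChange_pairing, eq_ratCast]

lemma span_range_h'_eq_top :
    Submodule.span ℂ (range (lieBasis b B).h') = ⊤ := by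
  rw [eq_top_iff]
  rintro ⟨x, hx⟩ -
  have hx' : x ∈ Submodule.span ℂ (range (lieBasis b B).h) := by
    rwa [← (lieBasis b B).coe_cartan_eq_span]
  rw [← Submodule.comap_map_eq_of_injective (cartan b B).toSubmodule.injective_subtype
    (Submodule.span ℂ (range (lieBasis b B).h')), Submodule.map_span, ← range_comp]
  exact hx'

/-- Both sides are linear forms on the span of the `h_j`. Since `h_j` is the coroot of the `j`-th
simple root, the left side takes there the Cartan integer of `α` and `α_j`, which the equivalence
preserves. -/
lemma root_indexEquiv_rootSystemEquiv (α : ι) :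
    (IsKilling.rootSystem (cartan b B)).root ((rootSystemEquiv b B).indexEquiv α) =
      dot b B α := by
  refine LinearMap.ext_on (span_range_h'_eq_top b B) ?_
  rintro - ⟨j, rfl⟩
  rw [dot_apply_h b B α j _ rfl, ← pairing_indexEquiv_rootSystemEquiv b B,
    indexEquiv_rootSystemEquiv, IsKilling.rootSystem_pairing_apply,
    LieAlgebra.Basis.coroot_eq_h', IsKilling.rootSystem_root_apply]
  rfl

/-- Generalized and true root spaces agree because `𝔥` acts diagonalizably when the Killing form is
nondegenerate. -/
lemma rootSpace_eq (lam : Module.Dual ℂ (cartan b B)) :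
    rootSpace b B lam = (LieAlgebra.rootSpace (cartan b B) lam).toSubmodule := by
  ext x
  refine ⟨fun hx ↦ (LieModule.mem_genWeightSpace _ _ _).mpr fun y ↦ ⟨1, ?_⟩, fun hx y ↦
    IsKilling.lie_eq_smul_of_mem_rootSpace hx y⟩
  have : ⁅(y : lieAlg b B), x⁆ = lam y • x := hx y
  simp [this]

lemma dot_ne_zero (α : ι) : dot b B α ≠ 0 := by
  rw [← root_indexEquiv_rootSystemEquiv]
  exact (IsKilling.rootSystem (cartan b B)).ne_zero _

lemma setOf_rootSpace_ne_bot :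
    {lam : Module.Dual ℂ (cartan b B) | lam ≠ 0 ∧ rootSpace b B lam ≠ ⊥} = range (dot b B) := by
  ext lam
  constructor
  · rintro ⟨h₀, h₁⟩
    rw [rootSpace_eq, ne_eq, LieSubmodule.toSubmodule_eq_bot] at h₁
    let χ : LieModule.Weight ℂ (cartan b B) (lieAlg b B) := ⟨lam, h₁⟩
    have hχ : χ ∈ (cartan b B).root := by
      simp only [LieSubalgebra.root, Finset.mem_filter, Finset.mem_univ, true_and]
      exact fun h ↦ h₀ (LinearMap.ext fun x ↦ congr_fun h x)
    refine ⟨(rootSystemEquiv b B).indexEquiv.symm ⟨χ, hχ⟩, ?_⟩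
    rw [← root_indexEquiv_rootSystemEquiv, Equiv.apply_symm_apply, IsKilling.rootSystem_root_apply]
    rfl
  · rintro ⟨α, rfl⟩
    refine ⟨dot_ne_zero b B α, ?_⟩
    rw [rootSpace_eq, ne_eq, LieSubmodule.toSubmodule_eq_bot, ← root_indexEquiv_rootSystemEquiv]
    exact ((rootSystemEquiv b B).indexEquiv α).1.genWeightSpace_ne_bot

lemma finrank_rootSpace (α : ι) : finrank ℂ (rootSpace b B (dot b B α)) = 1 := by
  rw [rootSpace_eq, ← root_indexEquiv_rootSystemEquiv]
  exact IsKilling.finrank_rootSpace_eq_one _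
    ((cartan b B).isNonZero_coe_root ((rootSystemEquiv b B).indexEquiv α))

lemma dot_injective : Function.Injective (dot b B) := by
  intro α β hαβ
  rw [← root_indexEquiv_rootSystemEquiv, ← root_indexEquiv_rootSystemEquiv] at hαβ
  exact (rootSystemEquiv b B).indexEquiv.injective
    ((IsKilling.rootSystem (cartan b B)).root.injective hαβ)

lemma isInternal_rootSpace :
    DirectSum.IsInternal (fun o : Option ι ↦
      o.elim (cartan b B).toSubmodule (fun α ↦ rootSpace b B (dot b B α))) := by
  -- `none` stands for the weight `0`, whose weight space is the Cartan subalgebra itself. Then `χ`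
  -- lists every weight exactly once, and the claim is the weight space decomposition of `𝔤`.
  let χ : Option ι → cartan b B → ℂ := fun o ↦ o.elim 0 (fun α ↦ dot b B α)
  have hχ : Function.Injective χ := by
    rintro (- | α) (- | β) h
    · rfl
    · exact absurd (LinearMap.ext fun x ↦ (congr_fun h x).symm) (dot_ne_zero b B β)
    · exact absurd (LinearMap.ext fun x ↦ congr_fun h x) (dot_ne_zero b B α)
    · exact congr_arg some (dot_injective b B (LinearMap.ext fun x ↦ congr_fun h x))
  have heq : (fun o : Option ι ↦
      o.elim (cartan b B).toSubmodule (fun α ↦ rootSpace b B (dot b B α))) =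
      fun o ↦ (LieAlgebra.rootSpace (cartan b B) (χ o)).toSubmodule := by
    funext o
    rcases o with (- | α)
    · exact congr_arg LieSubmodule.toSubmodule (rootSpace_zero_eq ℂ _ (cartan b B)).symm
    · exact rootSpace_eq b B _
  rw [heq, DirectSum.isInternal_submodule_iff_iSupIndep_and_iSup_eq_top,
    LieSubmodule.iSupIndep_toSubmodule, ← LieSubmodule.iSup_toSubmodule,
    LieSubmodule.toSubmodule_eq_top]
  refine ⟨(LieModule.iSupIndep_genWeightSpace ℂ (cartan b B) (lieAlg b B)).comp hχ, ?_⟩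
  rw [eq_top_iff, ← LieModule.iSup_genWeightSpace_eq_top' ℂ (cartan b B) (lieAlg b B), iSup_le_iff]
  intro ψ
  by_cases hψ : ψ.IsZero
  · exact le_iSup_of_le none (le_of_eq (congr_arg _ hψ))
  · obtain ⟨α, hα⟩ := (setOf_rootSpace_ne_bot b B).le (show ψ.toLinear ∈ _ from
      ⟨fun h ↦ hψ (funext fun x ↦ LinearMap.congr_fun h x), by
        rw [rootSpace_eq, ne_eq, LieSubmodule.toSubmodule_eq_bot]
        exact ψ.genWeightSpace_ne_bot⟩)
    exact le_iSup_of_le (some α) (le_of_eq (congr_arg _ (funext fun x ↦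
      (LinearMap.congr_fun hα x).symm)))

lemma exists_injective_forall_root_eq_dot :
    ∃ φ : E →ₗ[ℚ] Module.Dual ℂ (cartan b B),
      Function.Injective φ ∧ ∀ α, φ (P.root α) = dot b B α := by
  -- The map is `x ↦ 1 ⊗ x` followed by the bijective complex weight map.
  refine ⟨(rootSystemEquiv b B).weightMap.restrictScalars ℚ ∘ₗ TensorProduct.mk ℚ ℂ E 1, ?_, ?_⟩
  · exact (rootSystemEquiv b B).bijective_weightMap.injective.comp (oneTmul_injective ℂ E)
  · intro α
    rw [← root_indexEquiv_rootSystemEquiv, ← Hom.root_weightMap_apply, baseChange_root]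
    rfl

end CanonicalModel

theorem theorem3p6 {ι E N V : Type*} [Finite ι] [DecidableEq ι]
    [AddCommGroup E] [Module ℚ E] [AddCommGroup N] [Module ℚ N]
    [AddCommGroup V] [Module ℂ V]
    (P : RootPairing ι ℚ E N) [P.IsRootSystem] [P.IsCrystallographic] [P.IsReduced]
    [P.IsIrreducible] (b : P.Base) (B : Module.Basis (b.support ⊕ ι) ℂ V) :
    -- the `h_i` lie in `𝔤`, `𝔤` is simple, and `𝔥` is a Cartan subalgebra of `𝔤`
    CanonicalModel.hSpan b B ≤ CanonicalModel.lieAlg b B ∧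
    ∃ (_ : LieAlgebra.IsSimple ℂ (CanonicalModel.lieAlg b B))
      (_ : (CanonicalModel.cartan b B).IsCartanSubalgebra),
      -- the roots of `𝔤` with respect to `𝔥` are exactly the `α̇`
      {lam : Module.Dual ℂ (CanonicalModel.cartan b B) |
        lam ≠ 0 ∧ CanonicalModel.rootSpace b B lam ≠ ⊥} =
        Set.range (CanonicalModel.dot b B) ∧
      -- `α ↦ α̇` extends to an injective `ℚ`-linear map on `E`, and it is an isomorphism from `Φ`
      -- onto the root system of `𝔤` with respect to `𝔥` (it respects the Cartan integers)
      (∃ φ : E →ₗ[ℚ] Module.Dual ℂ (CanonicalModel.cartan b B),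
        Function.Injective φ ∧ ∀ α, φ (P.root α) = CanonicalModel.dot b B α) ∧
      (∃ ε : ι ≃ (CanonicalModel.cartan b B).root,
        (∀ α, (LieAlgebra.IsKilling.rootSystem (CanonicalModel.cartan b B)).root (ε α) =
          CanonicalModel.dot b B α) ∧
        ∀ α β, (LieAlgebra.IsKilling.rootSystem (CanonicalModel.cartan b B)).pairing (ε α) (ε β) =
          (P.pairing α β : ℂ)) ∧
      -- `𝔤 = 𝔥 ⊕ ⨁_α 𝔤_α` with all `𝔤_α` one-dimensional
      DirectSum.IsInternal (fun o : Option ι =>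
        o.elim (CanonicalModel.cartan b B).toSubmodule
          (fun α => CanonicalModel.rootSpace b B (CanonicalModel.dot b B α))) ∧
      ∀ α, Module.finrank ℂ (CanonicalModel.rootSpace b B (CanonicalModel.dot b B α)) = 1 := by
  have := Fintype.ofFinite ι
  exact ⟨CanonicalModel.hSpan_le_lieAlg b B, CanonicalModel.isSimple_lieAlg b B, inferInstance,
    CanonicalModel.setOf_rootSpace_ne_bot b B,
    CanonicalModel.exists_injective_forall_root_eq_dot b B,
    ⟨(CanonicalModel.rootSystemEquiv b B).indexEquiv,
      CanonicalModel.root_indexEquiv_rootSystemEquiv b B,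
      CanonicalModel.pairing_indexEquiv_rootSystemEquiv b B⟩,
    CanonicalModel.isInternal_rootSpace b B, CanonicalModel.finrank_rootSpace b B⟩
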